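/- A nonempty finite word $x$ whose length is divisible by $23$ has the $\frac{27}{23}$-power $x^{27/23} = x\,y$, where $y$ is the prefix of $x$ of length $\frac{4}{23}|x|$; an infinite word is $\frac{27}{23}$-power-free if none of its factors is of this form. Let $\mathbf{w}_{27/23}$ be the lexicographically least infinite $\frac{27}{23}$-power-free word on the alphabet $\mathbb{Z}_{\geq 0}$. Let $0'$ be a letter not in $\mathbb{Z}_{\geq 0}$, and let $\tau$ be the coding on $\mathbb{Z}_{\geq 0} \cup \{0'\}$ with $\tau(0') = 0$ and $\tau(n) = n$ for $n \in \mathbb{Z}_{\geq 0}$. Theorem. The word $\mathbf{w}_{27/23}$ exists, and there are a word $u \in \{0,1,2\}^*$ of length $|u| = 352$ and a word $v$ of length $|v| = 75019$, whose first letter is $0'$ and whose other letters all lie in $\{0,1,2\}$, such that $\mathbf{w}_{27/23} = \tau(\varphi^\infty(0'))$, where $\varphi$ is the morphism on $\mathbb{Z}_{\geq 0} \cup \{0'\}$ given by \[ \varphi(0') = v\,\varphi(0), \qquad \varphi(n) = u\,n \quad (n \in \mathbb{Z}_{\geq 0}), \] and $\varphi^\infty(0')$ is the infinite word having every iterate $\varphi^m(0')$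 as a prefix. In particular, every letter of $\mathbf{w}_{27/23}$ lies in $\{0,1,2\}$, and its sequence of letters is $353$-automatic, that is, its $i$th letter is computed by a deterministic finite automaton with output reading the base-$353$ digits of $i$. -/

import Mathlib

namespace Words

/-! ### Fractional powers -/

/-- The fractional power `x^(a/b)` of a finite word `x` whose length is divisible by `b`:
`⌊a/b⌋` copies of `x` followed by the prefix of `x` of length `|x| * FractionalPart(a/b)`.
Since `b ∣ |x|`, the division `|x| * (a % b) / b` is exact. -/
def fracPow {α : Type*} (a b : ℕ) (x : List α) : List α :=
  (List.replicate (a / b) x).flatten ++ x.take (x.length * (a % b) / b)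

/-- A finite word `y` is an `a/b`-power if `y = x^(a/b)` for some nonempty word `x` whose length
is divisible by `b`. -/
def IsFracPower {α : Type*} (a b : ℕ) (y : List α) : Prop :=
  ∃ x : List α, x ≠ [] ∧ b ∣ x.length ∧ y = fracPow a b x

/-- The factor of length `n` of the infinite word `w` starting at position `i`. -/
def factor {α : Type*} (w : ℕ → α) (i n : ℕ) : List α :=
  (List.range n).map fun j => w (i + j)

/-- An infinite word is `a/b`-power-free if none of its factors is an `a/b`-power. -/
def PowerFree {α : Type*} (a b : ℕ) (w : ℕ → α) : Prop :=
  ∀ i n : ℕ, ¬ IsFracPower a b (factor w i n)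

/-- `w` is the lexicographically least infinite `a/b`-power-free word on the alphabet of
non-negative integers.  (`Lex (ℕ → ℕ)` carries the lexicographic order on infinite words.) -/
def IsLexLeastPowerFree (a b : ℕ) (w : ℕ → ℕ) : Prop :=
  IsLeast {x : Lex (ℕ → ℕ) | PowerFree a b (ofLex x)} (toLex w)

/-- There is at most one lexicographically least `a/b`-power-free word. -/
theorem IsLexLeastPowerFree.unique {a b : ℕ} {w w' : ℕ → ℕ}
    (h : IsLexLeastPowerFree a b w) (h' : IsLexLeastPowerFree a b w') : w = w' :=
  toLex.injective (IsLeast.unique h h')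

/-! ### Morphisms and their iteration -/

/-- The extension by concatenation, to finite words, of a morphism given on letters. -/
def extend {α : Type*} (φ : α → List α) (x : List α) : List α :=
  x.flatMap φ

/-- The infinite word `φ^∞(c)`: its letter at position `i` is the letter at position `i` of
`φ^i(c)`.  It is meaningful when `φ(c)` begins with `c`, is longer than one letter, and no
letter is erased; then `φ^i(c)` has more than `i` letters, and every `φ^n(c)` is a prefix of
`φ^∞(c)`: see `factor_iterLimit`. -/
def iterLimit {α : Type*} (φ : α → List α) (c : α) (i : ℕ) : α :=
  (((extend φ)^[i] [c])[i]?).getD c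

theorem iterate_prefix_succ {α : Type*} {φ : α → List α} {c : α} {y : List α}
    (hc : φ c = c :: y) (n : ℕ) :
    (extend φ)^[n] [c] <+: (extend φ)^[n + 1] [c] := by
  induction n with
  | zero => exact ⟨y, by simp [extend, hc]⟩
  | succ n ih =>
    obtain ⟨t, ht⟩ := ih
    refine ⟨extend φ t, ?_⟩
    calc (extend φ)^[n + 1] [c] ++ extend φ t
        = extend φ ((extend φ)^[n] [c] ++ t) := by
          rw [Function.iterate_succ_apply']
          simp [extend]
      _ = (extend φ)^[n + 1 + 1] [c] := by
          rw [ht, Function.iterate_succ_apply' _ (n + 1)]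

theorem iterate_prefix {α : Type*} {φ : α → List α} {c : α} {y : List α}
    (hc : φ c = c :: y) {m n : ℕ} (h : m ≤ n) :
    (extend φ)^[m] [c] <+: (extend φ)^[n] [c] := by
  induction n, h using Nat.le_induction with
  | base => exact List.prefix_refl _
  | succ n _ ih => exact ih.trans (iterate_prefix_succ hc n)

theorem length_le_extend {α : Type*} {φ : α → List α} (hne : ∀ a, φ a ≠ []) (x : List α) :
    x.length ≤ (extend φ x).length := by
  induction x with
  | nil => simp
  | cons a x ih =>
    have := List.length_pos_iff.2 (hne a)
    simp only [extend, List.flatMap_cons, List.length_append, List.length_cons] at *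
    omega

theorem lt_length_iterate {α : Type*} {φ : α → List α} {c : α} {y : List α}
    (hne : ∀ a, φ a ≠ []) (hc : φ c = c :: y) (hy : y ≠ []) (n : ℕ) :
    n < ((extend φ)^[n] [c]).length := by
  suffices h : ∃ t, (extend φ)^[n] [c] = c :: t ∧ n ≤ t.length by
    obtain ⟨t, h1, h2⟩ := h
    rw [h1, List.length_cons]
    omega
  induction n with
  | zero => exact ⟨[], rfl, le_rfl⟩
  | succ n ih =>
    obtain ⟨t, h1, h2⟩ := ih
    refine ⟨y ++ extend φ t, ?_, ?_⟩
    · rw [Function.iterate_succ_apply', h1]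
      simp [extend, hc]
    · have := List.length_pos_iff.2 hy
      have := length_le_extend hne t
      rw [List.length_append]
      omega

/-- Every `φ^n(c)` is a prefix of `φ^∞(c)`. -/
theorem factor_iterLimit {α : Type*} {φ : α → List α} {c : α} {y : List α}
    (hne : ∀ a, φ a ≠ []) (hc : φ c = c :: y) (hy : y ≠ []) (n : ℕ) :
    factor (iterLimit φ c) 0 ((extend φ)^[n] [c]).length = (extend φ)^[n] [c] := by
  apply List.ext_getElem
  · simp [factor]
  · intro i h1 h2
    have hi := lt_length_iterate hne hc hy i
    have key : ((extend φ)^[i] [c])[i] = ((extend φ)^[n] [c])[i] := by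
      rcases le_total i n with h | h
      · exact (iterate_prefix hc h).getElem hi
      · exact ((iterate_prefix hc h).getElem h2).symm
    simp [factor, iterLimit, List.getElem?_eq_getElem hi, key]

/-! ### The alphabet `ℤ≥0 ∪ {0'}` -/

/-- The alphabet of the non-negative integers together with one new letter `0'`. -/
inductive Letter where
  | zeroPrime : Letter
  | int (n : ℕ) : Letter

/-- The coding `τ`, with `τ(0') = 0` and `τ(n) = n`. -/
def tau : Letter → ℕ
  | .zeroPrime => 0
  | .int n => n

/-- The morphism with `φ(n) = u n` for an integer letter `n`, and `φ(0') = v φ(0)`. -/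
def phi (u : List ℕ) (v : List Letter) : Letter → List Letter
  | .zeroPrime => v ++ (u.map Letter.int ++ [Letter.int 0])
  | .int n => u.map Letter.int ++ [Letter.int n]

/-! ### Automatic sequences -/

/-- The integer represented in base `k` by a word of digits, most significant digit first
(leading zeros are allowed). -/
def baseValue {k : ℕ} (x : List (Fin k)) : ℕ :=
  x.foldl (fun n d => k * n + d) 0

/-- A sequence `s` is `k`-automatic if some deterministic finite automaton with output, with
states `Q`, initial state `q₀`, transition function `δ` and output function `out`, computes
`s n` from every base-`k` representation of `n`. -/
def IsAutomatic {Δ : Type*} (k : ℕ) (s : ℕ → Δ) : Prop :=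
  ∃ (Q : Type) (_ : Finite Q) (q₀ : Q) (δ : Q → Fin k → Q) (out : Q → Δ),
    ∀ x : List (Fin k), s (baseValue x) = out (x.foldl δ q₀)

end Words

/-! The least word `w` is studied with one extra letter in front. In `1 w`, from position 75019 on,
position `75019 + 353 * j` repeats the letter at position `j`, and every other letter depends only
on its residue mod 353. A 27/23-power is determined by its start and a parameter `k`: `4 * k`
consecutive letters recur at distance `23 * k`.

Power-freeness (`leastWord_exists_ne`): a power inside the first 75725 letters is excluded by
computation. One that starts before position 75019 and runs past 75725 would repeat a factor of
length 100 among the blocks, which the fixed letters forbid. Among the blocks, if 353 does not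
divide `k`, the fixed letters clash with their shift; otherwise the block-initial letters form a
power with parameter `k / 353`, and induction applies.

Minimality (`exists_power_of_lt`): decreasing a letter of `w` must complete a power. This is
computed up to 75725; a fixed letter further on is handled by a short power avoiding the variable
positions, and a block-initial letter by enlarging a power for the letter it repeats by the factor
353.

The finite checks encode words as bit masks, so that one operation on integers treats all positions
at once. -/

namespace LeastPowerFree

/-! ### Bit masks -/

/-- The union of the shifts `D >>> l` for `l < L`, computed by doubling; the first number bounds
the depth of the recursion. -/
def hitMask (D : ℕ) : ℕ → ℕ → ℕ
  | 0, _ => D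
  | d + 1, L => bif Nat.ble L 1 then D else
      hitMask D d ((L + 1) / 2) ||| (hitMask D d ((L + 1) / 2) >>> (L / 2))

/-- The positions at which the words with masks `(A, T)` and `(A', T')` differ. -/
def diffMask (A T A' T' : ℕ) : ℕ := (A ^^^ A') ||| (T ^^^ T')

/-- Are the `n` lowest bits of `x` all equal to `1`? -/
def allOnes (x n : ℕ) : Bool := Nat.beq (x % 2 ^ n) (2 ^ n - 1)

/-- Does `f` hold on the interval `[b, b + 2^d)`? -/
def allDyadic (f : ℕ → Bool) : ℕ → ℕ → Bool
  | 0, b => f b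
  | d + 1, b => allDyadic f d b && allDyadic f d (b + 2 ^ d)

/-- The mask obtained by repeating a block of `n` bits `2^d` times. -/
def tile (x n : ℕ) : ℕ → ℕ
  | 0 => x
  | d + 1 => tile x n d ||| (tile x n d <<< (n * 2 ^ d))

/-- The positions of `S` at which no power with a parameter from the list ends when the letter is
replaced: `D k` marks the mismatches for the period `23 * k`, and `C` marks the positions that do
not hold the replacing letter. -/
def uncovered (D : ℕ → ℕ) (C S : ℕ) : List ℕ → ℕ
  | [] => S
  | k :: ks => uncovered D C S ks &&&
      (((hitMask (D k) 14 (4 * k - 1) <<< (27 * k - 1)) ||| (C <<< (23 * k))) |||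
        (2 ^ (27 * k) - 1))

/-- The windows `[0, ⌈L/2⌉)` and `[⌊L/2⌋, L)` cover `[0, L)`, so `d` halvings suffice once `L ≤ 2 ^
d`. -/
theorem testBit_hitMask (D : ℕ) {d L : ℕ} (hL : 1 ≤ L) (hd : L ≤ 2 ^ d) (p : ℕ) :
    (hitMask D d L).testBit p = true ↔ ∃ l < L, D.testBit (p + l) = true := by
  induction d generalizing L p with
  | zero =>
    obtain rfl : L = 1 := by simp at hd; omega
    simp [hitMask]
  | succ d ih =>
    rcases Nat.lt_or_ge 1 L with h | h
    · have hf : Nat.ble L 1 = false := by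
        rw [Bool.eq_false_iff, Ne, Nat.ble_eq]; omega
      have h2 : (L + 1) / 2 ≤ 2 ^ d := by rw [pow_succ] at hd; omega
      rw [hitMask, hf, cond_false, Nat.testBit_or, Nat.testBit_shiftRight, Bool.or_eq_true,
        ih (by omega) h2, ih (by omega) h2]
      constructor
      · rintro (⟨l, h3, h4⟩ | ⟨l, h3, h4⟩)
        · exact ⟨l, by omega, h4⟩
        · exact ⟨L / 2 + l, by omega, by rwa [show p + (L / 2 + l) = L / 2 + p + l by omega]⟩
      · rintro ⟨l, h3, h4⟩
        rcases Nat.lt_or_ge l ((L + 1) / 2) with h5 | h5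
        · exact Or.inl ⟨l, h5, h4⟩
        · exact Or.inr ⟨l - L / 2, by omega,
            by rwa [show L / 2 + p + (l - L / 2) = p + l by omega]⟩
    · obtain rfl : L = 1 := by omega
      simp [hitMask, show Nat.ble 1 1 = true from rfl]

theorem testBit_diffMask (A T A' T' p : ℕ) :
    (diffMask A T A' T').testBit p = false ↔
      A.testBit p = A'.testBit p ∧ T.testBit p = T'.testBit p := by
  simp [diffMask]

theorem testBit_two_pow_sub_one_of_lt {n p : ℕ} (h : p < n) : (2 ^ n - 1).testBit p = true := by
  rw [Nat.testBit_two_pow_sub_one]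
  simpa

theorem testBit_mod_two_pow_of_lt {n p : ℕ} (x : ℕ) (h : p < n) :
    (x % 2 ^ n).testBit p = x.testBit p := by
  simp [h]

theorem testBit_shiftRight_mod_two_pow {n p : ℕ} (x m : ℕ) (h : p < n) :
    ((x >>> m) % 2 ^ n).testBit p = x.testBit (m + p) := by
  rw [testBit_mod_two_pow_of_lt _ h, Nat.testBit_shiftRight]

theorem testBit_of_allOnes {x n p : ℕ} (h : allOnes x n = true) (hp : p < n) :
    x.testBit p = true := by
  have h1 : x % 2 ^ n = 2 ^ n - 1 := Nat.eq_of_beq_eq_true h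
  have h2 : (x % 2 ^ n).testBit p = true := by rw [h1, Nat.testBit_two_pow_sub_one]; simpa
  simpa [hp] using h2

theorem of_allDyadic {f : ℕ → Bool} {d b : ℕ} (h : allDyadic f d b = true) {k : ℕ}
    (hb : b ≤ k) (hk : k < b + 2 ^ d) : f k = true := by
  induction d generalizing b with
  | zero =>
    obtain rfl : k = b := by simp at hk; omega
    exact h
  | succ d ih =>
    rw [allDyadic, Bool.and_eq_true] at h
    rw [pow_succ] at hk
    rcases Nat.lt_or_ge k (b + 2 ^ d) with h1 | h1
    · exact ih h.1 hb h1
    · exact ih h.2 h1 (by omega)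

theorem testBit_tile {x n : ℕ} (hx : x < 2 ^ n) {d p : ℕ} (hp : p < n * 2 ^ d) :
    (tile x n d).testBit p = x.testBit (p % n) := by
  have hlt : ∀ d, tile x n d < 2 ^ (n * 2 ^ d) := by
    intro d
    induction d with
    | zero => simpa [tile]
    | succ d ih =>
      have h2 : n * 2 ^ (d + 1) = n * 2 ^ d + n * 2 ^ d := by ring
      refine Nat.or_lt_two_pow (ih.trans_le (Nat.pow_le_pow_right two_pos (by omega))) ?_
      rw [h2, Nat.shiftLeft_eq, pow_add]
      exact Nat.mul_lt_mul_of_pos_right ih (by positivity)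
  induction d generalizing p with
  | zero => rw [tile, Nat.mod_eq_of_lt (by simpa using hp)]
  | succ d ih =>
    rw [tile, Nat.testBit_or, Nat.testBit_shiftLeft]
    rcases Nat.lt_or_ge p (n * 2 ^ d) with h | h
    · simp [ih h, Nat.not_le.2 h]
    · have h2 : n * 2 ^ (d + 1) = n * 2 ^ d + n * 2 ^ d := by ring
      have h3 : (tile x n d).testBit p = false :=
        Nat.testBit_lt_two_pow ((hlt d).trans_le (Nat.pow_le_pow_right two_pos h))
      have h4 : (p - n * 2 ^ d) % n = p % n := by
        conv_rhs => rw [← Nat.sub_add_cancel h, Nat.add_mul_mod_self_left]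
      rw [h3, ih (by omega), h4]
      simp [h]

/-- A position leaves `S` only when, for some `k`, all three obstructions vanish: a mismatch in the
window starting at `p + 1 - 27 * k`, a wrong letter at `p - 23 * k`, and too little room to the
left. -/
theorem exists_of_uncovered {D : ℕ → ℕ} {C S p : ℕ} {ks : List ℕ}
    (hks : ∀ k ∈ ks, 1 ≤ k ∧ 4 * k - 1 ≤ 2 ^ 14) (hS : S.testBit p = true)
    (h : (uncovered D C S ks).testBit p = false) :
    ∃ k ∈ ks, 27 * k ≤ p ∧ C.testBit (p - 23 * k) = false ∧
      ∀ l < 4 * k - 1, (D k).testBit (p + 1 - 27 * k + l) = false := by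
  induction ks with
  | nil => simp [uncovered, hS] at h
  | cons k ks ih =>
    obtain ⟨hk1, hk2⟩ := hks k (by simp)
    rw [uncovered, Nat.testBit_and, Bool.and_eq_false_iff] at h
    rcases h with h | h
    · obtain ⟨k', hk', h'⟩ := ih (fun k hk => hks k (by simp [hk])) h
      exact ⟨k', by simp [hk'], h'⟩
    · rw [Nat.testBit_or, Nat.testBit_or, Bool.or_eq_false_iff, Bool.or_eq_false_iff,
        Nat.testBit_shiftLeft, Nat.testBit_shiftLeft, Nat.testBit_two_pow_sub_one] at h
      obtain ⟨⟨h1, h2⟩, h3⟩ := h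
      have h4 : 27 * k ≤ p := by simpa using h3
      refine ⟨k, by simp, h4, ?_, fun l hl => ?_⟩
      · simpa [show 23 * k ≤ p by omega] using h2
      · have h5 : (hitMask (D k) 14 (4 * k - 1)).testBit (p - (27 * k - 1)) = false := by
          simpa [show 27 * k - 1 ≤ p by omega] using h1
        rw [Bool.eq_false_iff, Ne, testBit_hitMask _ (by omega) hk2] at h5
        rw [Bool.eq_false_iff]
        intro h6
        exact h5 ⟨l, hl, by rwa [show p - (27 * k - 1) + l = p + 1 - 27 * k + l by omega]⟩

/-! ### The data -/

/-- The pairs `(s, n)` for which the word is continued by copying the `n` letters from position `s`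
on. -/
def copies : List (ℕ × ℕ) :=
  -- Copies never overlap the part being written, so a long periodic run appears as successive
  -- doublings from one source.
  [(57, 668), (57, 1336), (57, 2672), (57, 5344), (57, 7345), (145, 4), (141, 8), (141, 16),
   (614, 50), (78, 23), (18090, 8), (238, 676), (18106, 20), (266, 664), (43, 16), (468, 43),
   (528, 27), (602, 31), (18191, 15), (27, 16), (664, 64), (340, 19), (351, 22), (19785, 16),
   (397, 13), (19779, 49), (343, 13), (402, 15), (19767, 151), (19767, 302), (19767, 604),
   (19767, 1208), (19767, 1659), (19779, 19), (74, 14), (23848, 27), (19839, 14), (75, 21),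
   (23910, 27), (23856, 14), (23862, 19), (532, 21), (23991, 27), (19833, 21), (23842, 224),
   (23842, 448), (23842, 896), (23842, 1792), (23842, 2462), (19914, 1447), (722, 21), (20, 10),
   (354, 17), (0, 10), (19820, 13), (506, 34), (374, 36), (31379, 22), (18, 17), (325, 11),
   (466, 12), (514, 22), (424, 20), (325, 8), (31398, 10), (117, 11), (31432, 15), (450, 18),
   (544, 23), (31515, 13), (143, 10), (23991, 21), (450, 16), (31424, 25), (31383, 14),
   (31366, 35), (31627, 18), (19819, 13), (31432, 20), (31753, 22), (31331, 13), (31761, 24),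
   (348, 19), (394, 23), (31784, 24), (18189, 15), (31511, 17), (419, 29), (31858, 19), (409, 15),
   (31527, 17), (19822, 15), (31802, 16), (31607, 19), (61, 19), (510, 12), (32071, 22),
   (505, 19), (31791, 21), (19814, 18), (32093, 19), (32170, 23), (31331, 12), (31760, 42),
   (31501, 24), (31826, 27), (31680, 13), (31839, 18), (145, 9), (32102, 18), (31884, 46),
   (23904, 17), (31588, 11), (23986, 43), (32156, 14), (31565, 22), (32575, 13), (32147, 19),
   (31833, 21), (43, 18), (19559, 21), (32071, 19), (32148, 24), (31603, 1138), (31603, 2276),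
   (31603, 4552), (31603, 9104), (31603, 12513), (71, 19), (32186, 34), (31651, 24), (32244, 27),
   (199, 12), (31838, 39), (31974, 22), (346, 12), (32426, 15), (674, 16), (19820, 17),
   (31684, 26), (424, 19), (31950, 21), (19895, 22), (362, 31), (366, 23), (19820, 21),
   (62573, 151), (62573, 302), (62573, 604), (62573, 1208), (62573, 1649), (32516, 16), (291, 28),
   (32146, 30), (219, 39), (32672, 29), (540, 47), (32673, 25), (465, 10), (66787, 44),
   (66755, 151), (66755, 302), (66755, 604), (66755, 1208), (66755, 1644), (656, 18), (32108, 21),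
   (18090, 8), (32137, 3956), (266, 52), (62557, 21), (339, 14), (62565, 40), (323, 14),
   (31742, 17), (74949, 16), (74943, 21), (32553, 21), (32235, 22), (31639, 23), (74949, 14),
   (416, 18), (74986, 33), (75068, 24), (75043, 27), (32426, 14), (75057, 37), (75192, 22),
   (31429, 17), (74981, 35), (74967, 51), (75094, 22), (75040, 332)]

/-- The continuation of a mask of `n` bits by copying. -/
def extendMask : List (ℕ × ℕ) → ℕ → ℕ → ℕ
  | [], _, x => x
  | (s, l) :: cs, n, x => extendMask cs (n + l) (x ||| (((x >>> s) % 2 ^ l) <<< n))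

/-- The positions of the letter `1` in the first `75725` letters. -/
@[irreducible] def ones : ℕ :=
  extendMask copies 725
    0xc088880800010101011020200204040040c08c08080081011010440888008001441011008210321042204208080841018108881020020204406060440404008080808818100101020020204606040040408808080888888000001

/-- The positions of the letter `2` in the first `75725` letters. -/
@[irreducible] def twos : ℕ :=
  extendMask copies 725
    0x10100000000000004000000000000000000000000000000000000100000000000000000000000000000000000000000000000000000000000000080000000000002000000000000000000000000000000000000

/-- The letters `1` in the block, of length `353`. -/
@[irreducible] def blockOnes : ℕ := (ones >>> 75019) % 2 ^ 353

/-- The letters `2` in the block. -/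
@[irreducible] def blockTwos : ℕ := (twos >>> 75019) % 2 ^ 353

/-- The positions of the block other than the first. -/
def blockFixed : ℕ := 2 ^ 353 - 2

/-- The positions `p` of the word at which it differs from the position `p + 23 * k`. -/
def wordDiff (k : ℕ) : ℕ := diffMask ones twos (ones >>> (23 * k)) (twos >>> (23 * k))

/-- Does no power with parameter `k` lie in the first `75725` letters? -/
def powerCheck (k : ℕ) : Bool :=
  Nat.ble 75726 (27 * k) ||
    (allOnes (hitMask (wordDiff k) 7 (min (4 * k) 128)) (75726 - 27 * k) ||
      allOnes (hitMask (wordDiff k) 14 (4 * k)) (75726 - 27 * k))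

/-- Is no factor of length `100` starting in the first `75019` letters compatible with the periodic
word from the residue `r` on? -/
def blockCheck (r : ℕ) : Bool :=
  allOnes (hitMask (diffMask ones twos (tile blockOnes 353 8 >>> r) (tile blockTwos 353 8 >>> r)
    &&& (tile blockFixed 353 8 >>> r)) 7 100) 75019

/-- The fixed positions `p` of the periodic word at which it differs from the position `p + 23 * k`,
if that is fixed as well. -/
def blockDiff (k : ℕ) : ℕ :=
  diffMask (tile blockOnes 353 5) (tile blockTwos 353 5)
    (tile blockOnes 353 5 >>> (23 * k)) (tile blockTwos 353 5 >>> (23 * k)) &&&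
      (tile blockFixed 353 5 &&& (tile blockFixed 353 5 >>> (23 * k)))

/-- Is every factor of length `4 * k` of the periodic word incompatible with its shift? -/
def shiftCheck (k : ℕ) : Bool :=
  Nat.ble 353 k || allOnes (hitMask (blockDiff k) 14 (4 * k)) 353

/-- The positions `p` of the periodic word at which it may differ from the position `p + 23 * k`. -/
def blockDiff' (k : ℕ) : ℕ :=
  diffMask (tile blockOnes 353 5) (tile blockTwos 353 5)
    (tile blockOnes 353 5 >>> (23 * k)) (tile blockTwos 353 5 >>> (23 * k)) |||
      ((2 ^ 1412 - 1) ^^^ (tile blockFixed 353 5 &&& (tile blockFixed 353 5 >>> (23 * k))))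

/-- The parameters of the powers that exclude smaller letters in the word. -/
def parameters : List ℕ := [1, 2, 3, 4, 18, 151, 171, 224, 368, 668, 991, 1138]

/-- The parameters of the powers that exclude smaller letters in the periodic word. -/
def parameters' : List ℕ := [1, 2, 3, 4, 5, 6, 7, 8, 9, 10]

/-- The variable positions of the periodic word. -/
def blockVar : ℕ := (2 ^ 1412 - 1) ^^^ tile blockFixed 353 5

/-! ### Finite verifications -/

theorem allDyadic_powerCheck₁ : allDyadic powerCheck 11 1 = true := by decide +kernel

/-- The two ranges reach `k = 3072`; a power in 75725 letters has `k ≤ 2804`. -/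
theorem allDyadic_powerCheck₂ : allDyadic powerCheck 10 2049 = true := by decide +kernel

theorem allDyadic_blockCheck : allDyadic blockCheck 9 0 = true := by decide +kernel

theorem allDyadic_shiftCheck : allDyadic shiftCheck 9 1 = true := by decide +kernel

/-- The two shifts by 1 clear bit 0, because the extra front letter need not be minimal. -/
theorem uncovered_zero :
    uncovered wordDiff (ones ||| twos) (((ones ||| twos) % 2 ^ 75725) >>> 1 <<< 1) parameters =
      0 := by
  decide +kernel

theorem uncovered_one :
    uncovered wordDiff ((2 ^ 75725 - 1) ^^^ ones) ((twos % 2 ^ 75725) >>> 1 <<< 1) parameters =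
      0 := by
  decide +kernel

theorem uncovered_block_zero :
    uncovered blockDiff' (blockVar ||| (tile blockOnes 353 5 ||| tile blockTwos 353 5))
      (((blockOnes ||| blockTwos) &&& blockFixed) <<< 353) parameters' = 0 := by
  decide +kernel

theorem uncovered_block_one :
    uncovered blockDiff' (blockVar ||| ((2 ^ 1412 - 1) ^^^ tile blockOnes 353 5))
      ((blockTwos &&& blockFixed) <<< 353) parameters' = 0 := by
  decide +kernel

theorem ones_and_twos : ones &&& twos = 0 := by decide +kernel

/-- The masks extend `2 * 353` letters past 75019; this and the next three facts make those two
blocks agree with the recursion. -/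
theorem second_block_ones : (ones >>> 75372) % 2 ^ 353 &&& blockFixed = blockOnes &&& blockFixed := by
  decide +kernel

theorem second_block_twos : (twos >>> 75372) % 2 ^ 353 &&& blockFixed = blockTwos &&& blockFixed := by
  decide +kernel

theorem initial_ones : ones.testBit 1 = false ∧ ones.testBit 75019 = ones.testBit 0 ∧
    ones.testBit 75372 = ones.testBit 1 := by
  decide +kernel

theorem initial_twos : twos.testBit 1 = false ∧ twos.testBit 75019 = twos.testBit 0 ∧
    twos.testBit 75372 = twos.testBit 1 := by
  decide +kernel

theorem blockFixed_eq : blockFixed = (2 ^ 352 - 1) <<< 1 := by decide +kernel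

end LeastPowerFree

namespace LeastPowerFree

/-! ### The word and its block structure -/

/-- The letter at position `p < 75725`, read off the masks. -/
def letter (p : ℕ) : ℕ := (ones.testBit p).toNat + 2 * (twos.testBit p).toNat

/-- The word `1 w`, where `w` is the least word: after the first `75019` letters it consists of
blocks of length `353`, whose first letters form the word itself and whose other letters are
fixed. -/
def leastWord (p : ℕ) : ℕ :=
  if p < 75019 then letter p
  else if (p - 75019) % 353 = 0 then leastWord ((p - 75019) / 353)
  else letter (75019 + (p - 75019) % 353)
termination_by p

theorem letter_eq_iff {p q : ℕ} :
    letter p = letter q ↔ ones.testBit p = ones.testBit q ∧ twos.testBit p = twos.testBit q := by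
  unfold letter
  cases ones.testBit p <;> cases ones.testBit q <;> cases twos.testBit p <;>
    cases twos.testBit q <;> simp

theorem not_testBit_ones_and_twos (p : ℕ) : ¬ (ones.testBit p = true ∧ twos.testBit p = true) := by
  have h : (ones &&& twos).testBit p = false := by rw [ones_and_twos, Nat.zero_testBit]
  simpa using h

theorem letter_le_two (p : ℕ) : letter p ≤ 2 := by
  have := not_testBit_ones_and_twos p
  unfold letter
  revert this
  cases ones.testBit p <;> cases twos.testBit p <;> simp

theorem letter_eq_zero_iff {p : ℕ} : letter p = 0 ↔ (ones ||| twos).testBit p = false := by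
  rw [Nat.testBit_or]
  unfold letter
  cases ones.testBit p <;> cases twos.testBit p <;> simp

theorem letter_eq_one {p : ℕ} (h : ones.testBit p = true) : letter p = 1 := by
  have := not_testBit_ones_and_twos p
  unfold letter
  revert this h
  cases ones.testBit p <;> cases twos.testBit p <;> simp

theorem testBit_of_one_lt_letter {p : ℕ} (h : 1 < letter p) : twos.testBit p = true := by
  unfold letter at h
  revert h
  cases ones.testBit p <;> cases twos.testBit p <;> simp

theorem leastWord_of_lt {p : ℕ} (h : p < 75019) : leastWord p = letter p := by
  rw [leastWord, if_pos h]

theorem leastWord_block (j : ℕ) : leastWord (75019 + 353 * j) = leastWord j := by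
  rw [leastWord, if_neg (by omega), if_pos (by omega)]
  congr 1
  omega

theorem leastWord_fixed {x : ℕ} (h : x % 353 ≠ 0) :
    leastWord (75019 + x) = letter (75019 + x % 353) := by
  rw [leastWord, if_neg (by omega), Nat.add_sub_cancel_left, if_neg h]

theorem leastWord_le_two (p : ℕ) : leastWord p ≤ 2 := by
  induction p using Nat.strong_induction_on with
  | _ p ih =>
    rw [leastWord]
    split_ifs with h1 h2
    · exact letter_le_two _
    · exact ih _ (by omega)
    · exact letter_le_two _

theorem testBit_blockFixed (i : ℕ) : blockFixed.testBit i = true ↔ i ≠ 0 ∧ i < 353 := by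
  rw [blockFixed_eq, Nat.testBit_shiftLeft, Nat.testBit_two_pow_sub_one, Bool.and_eq_true,
    decide_eq_true_eq, decide_eq_true_eq]
  omega

theorem testBit_blockOnes {i : ℕ} (h : i < 353) :
    blockOnes.testBit i = ones.testBit (75019 + i) := by
  unfold blockOnes
  exact testBit_shiftRight_mod_two_pow ones 75019 h

theorem testBit_blockTwos {i : ℕ} (h : i < 353) :
    blockTwos.testBit i = twos.testBit (75019 + i) := by
  unfold blockTwos
  exact testBit_shiftRight_mod_two_pow twos 75019 h

theorem letter_second_block {i : ℕ} (h0 : i ≠ 0) (h : i < 353) :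
    letter (75372 + i) = letter (75019 + i) := by
  have hf := (testBit_blockFixed i).2 ⟨h0, h⟩
  have h1 := congrArg (fun x => x.testBit i) second_block_ones
  have h2 := congrArg (fun x => x.testBit i) second_block_twos
  simp only [Nat.testBit_and, hf, Bool.and_true, Nat.testBit_mod_two_pow, h, decide_true,
    Bool.true_and, Nat.testBit_shiftRight, testBit_blockOnes h, testBit_blockTwos h] at h1 h2
  exact letter_eq_iff.2 ⟨h1, h2⟩

theorem leastWord_eq_letter {p : ℕ} (h : p < 75725) : leastWord p = letter p := by
  rcases Nat.lt_or_ge p 75019 with h1 | h1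
  · exact leastWord_of_lt h1
  obtain ⟨x, rfl⟩ := Nat.exists_eq_add_of_le h1
  by_cases hx : x % 353 = 0
  · obtain rfl | rfl : x = 0 ∨ x = 353 := by omega
    · rw [show 75019 + 0 = 75019 + 353 * 0 from rfl, leastWord_block, leastWord_of_lt (by omega)]
      exact letter_eq_iff.2 ⟨initial_ones.2.1.symm, initial_twos.2.1.symm⟩
    · rw [show 75019 + 353 = 75019 + 353 * 1 from rfl, leastWord_block, leastWord_of_lt (by omega)]
      exact letter_eq_iff.2 ⟨initial_ones.2.2.symm, initial_twos.2.2.symm⟩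
  · rw [leastWord_fixed hx]
    rcases Nat.lt_or_ge x 353 with h2 | h2
    · rw [Nat.mod_eq_of_lt h2]
    · rw [show 75019 + x = 75372 + x % 353 by omega, letter_second_block hx (by omega)]

theorem leastWord_one : leastWord 1 = 0 := by
  rw [leastWord_of_lt (by omega), letter, initial_ones.1, initial_twos.1]
  rfl

theorem blockFixed_lt : blockFixed < 2 ^ 353 := by
  unfold blockFixed
  omega

theorem blockOnes_lt : blockOnes < 2 ^ 353 := by
  unfold blockOnes
  exact Nat.mod_lt _ (by positivity)

theorem blockTwos_lt : blockTwos < 2 ^ 353 := by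
  unfold blockTwos
  exact Nat.mod_lt _ (by positivity)

theorem testBit_tile_fixed {d x : ℕ} (hx : x < 353 * 2 ^ d) :
    (tile blockFixed 353 d).testBit x = true ↔ x % 353 ≠ 0 := by
  rw [testBit_tile blockFixed_lt hx, testBit_blockFixed]
  omega

theorem testBit_tile_ones {d x : ℕ} (hx : x < 353 * 2 ^ d) :
    (tile blockOnes 353 d).testBit x = ones.testBit (75019 + x % 353) := by
  rw [testBit_tile blockOnes_lt hx, testBit_blockOnes (Nat.mod_lt _ (by omega))]

theorem testBit_tile_twos {d x : ℕ} (hx : x < 353 * 2 ^ d) :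
    (tile blockTwos 353 d).testBit x = twos.testBit (75019 + x % 353) := by
  rw [testBit_tile blockTwos_lt hx, testBit_blockTwos (Nat.mod_lt _ (by omega))]

theorem testBit_wordDiff {k p : ℕ} :
    (wordDiff k).testBit p = false ↔ letter p = letter (p + 23 * k) := by
  rw [wordDiff, testBit_diffMask, letter_eq_iff, Nat.testBit_shiftRight, Nat.testBit_shiftRight,
    Nat.add_comm (23 * k)]

/-! ### Power-freeness -/

/-- There is no power in the first `75725` letters. -/
theorem exists_ne_of_le {i k : ℕ} (hk : 0 < k) (h : i + 27 * k ≤ 75725) :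
    ∃ l < 4 * k, leastWord (i + l) ≠ leastWord (i + l + 23 * k) := by
  have hc : powerCheck k = true := by
    rcases Nat.lt_or_ge k 2049 with h1 | h1
    · exact of_allDyadic allDyadic_powerCheck₁ hk (by omega)
    · exact of_allDyadic allDyadic_powerCheck₂ h1 (by omega)
  have key : ∃ l < 4 * k, (wordDiff k).testBit (i + l) = true := by
    rw [powerCheck, Bool.or_eq_true, Bool.or_eq_true, Nat.ble_eq] at hc
    rcases hc with hc | hc | hc
    · omega
    -- A mismatch among the first 128 letters of the window is enough; the full window is only the
    -- fallback.
    · have := testBit_of_allOnes hc (p := i) (by omega)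
      rw [testBit_hitMask _ (by omega) (by omega)] at this
      obtain ⟨l, h1, h2⟩ := this
      exact ⟨l, by omega, h2⟩
    · have := testBit_of_allOnes hc (p := i) (by omega)
      rwa [testBit_hitMask _ (by omega) (by omega)] at this
  obtain ⟨l, hl, h1⟩ := key
  refine ⟨l, hl, fun h2 => ?_⟩
  rw [leastWord_eq_letter (by omega), leastWord_eq_letter (by omega), ← testBit_wordDiff, h1] at h2
  exact absurd h2 (by simp)

/-- A factor of length `100` that starts in the first `75019` letters does not occur later. -/
theorem exists_ne_of_lt {q s : ℕ} (hq : q < 75019) (hs : 75019 ≤ q + s) :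
    ∃ l < 100, leastWord (q + l) ≠ leastWord (q + l + s) := by
  obtain ⟨x, hx⟩ := Nat.exists_eq_add_of_le hs
  -- Since `75189 = 213 * 353` exceeds `q`, this gives `r + q ≡ x` mod 353 without truncated
  -- subtraction.
  set r := (x + (75189 - q)) % 353 with hr
  have h1 := testBit_of_allOnes (of_allDyadic allDyadic_blockCheck (k := r) (by omega) (by omega)) hq
  rw [testBit_hitMask _ (by omega) (by omega)] at h1
  obtain ⟨l, hl, h2⟩ := h1
  refine ⟨l, hl, fun h3 => ?_⟩
  have hb : r + (q + l) < 353 * 2 ^ 8 := by omega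
  have hm : (r + (q + l)) % 353 = (x + l) % 353 := by omega
  rw [Nat.testBit_and, Bool.and_eq_true, Nat.testBit_shiftRight, testBit_tile_fixed hb, hm] at h2
  rw [leastWord_eq_letter (by omega), show q + l + s = 75019 + (x + l) by omega,
    leastWord_fixed h2.2, letter_eq_iff] at h3
  have h4 := (testBit_diffMask ones twos (tile blockOnes 353 8 >>> r) (tile blockTwos 353 8 >>> r)
    (q + l)).2 (by rwa [Nat.testBit_shiftRight, Nat.testBit_shiftRight, testBit_tile_ones hb,
      testBit_tile_twos hb, hm])
  rw [h4] at h2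
  exact absurd h2.1 (by simp)

/-- Periods that are not divisible by `353` are excluded by the fixed letters of the blocks. -/
theorem exists_ne_of_not_dvd {x k : ℕ} (hk : ¬ 353 ∣ k) :
    ∃ l < 4 * k, leastWord (75019 + x + l) ≠ leastWord (75019 + x + l + 23 * k) := by
  -- Fixed letters see the shift `23 * k` only mod 353, and the window for `m` lies in that for `k`.
  set m := k % 353 with hm
  have hm0 : m ≠ 0 := by omega
  have hc := of_allDyadic allDyadic_shiftCheck (k := m) (by omega) (by omega)
  rw [shiftCheck, Bool.or_eq_true, Nat.ble_eq, or_iff_right (by omega)] at hc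
  have h1 := testBit_of_allOnes hc (p := x % 353) (by omega)
  rw [testBit_hitMask _ (by omega) (by omega)] at h1
  obtain ⟨l, hl, h2⟩ := h1
  refine ⟨l, by omega, fun h3 => ?_⟩
  have hb : x % 353 + l < 353 * 2 ^ 5 := by omega
  have hb' : 23 * m + (x % 353 + l) < 353 * 2 ^ 5 := by omega
  have hr : (x % 353 + l) % 353 = (x + l) % 353 := by omega
  have hr' : (23 * m + (x % 353 + l)) % 353 = (x + l + 23 * k) % 353 := by omega
  rw [blockDiff, Nat.testBit_and, Bool.and_eq_true, Nat.testBit_and, Bool.and_eq_true,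
    Nat.testBit_shiftRight, testBit_tile_fixed hb, testBit_tile_fixed hb', hr, hr'] at h2
  rw [show 75019 + x + l + 23 * k = 75019 + (x + l + 23 * k) by omega,
    show 75019 + x + l = 75019 + (x + l) by omega, leastWord_fixed h2.2.1, leastWord_fixed h2.2.2,
    letter_eq_iff] at h3
  have h4 := (testBit_diffMask (tile blockOnes 353 5) (tile blockTwos 353 5)
    (tile blockOnes 353 5 >>> (23 * m)) (tile blockTwos 353 5 >>> (23 * m)) (x % 353 + l)).2
    (by rwa [Nat.testBit_shiftRight, Nat.testBit_shiftRight, testBit_tile_ones hb,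
      testBit_tile_twos hb, testBit_tile_ones hb', testBit_tile_twos hb', hr, hr'])
  rw [h4] at h2
  exact absurd h2.1 (by simp)

/-- The induction may descend to position 0, so the extra front letter must be covered as well. -/
theorem leastWord_exists_ne (i : ℕ) {k : ℕ} (hk : 0 < k) :
    ∃ l < 4 * k, leastWord (i + l) ≠ leastWord (i + l + 23 * k) := by
  induction k using Nat.strong_induction_on generalizing i with
  | _ k ih =>
    rcases Nat.lt_or_ge i 75019 with hi | hi
    · rcases Nat.lt_or_ge 75725 (i + 27 * k) with h1 | h1
      -- The first place in the window whose shifted copy lies among the blocks; 100 letters of the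
      -- window remain there because `i + 27 * k > 75725`.
      · obtain ⟨q, hq⟩ : ∃ q, q = max i (75019 - 23 * k) := ⟨_, rfl⟩
        obtain ⟨l, hl, h⟩ := exists_ne_of_lt (q := q) (s := 23 * k) (by omega) (by omega)
        exact ⟨q - i + l, by omega, by rwa [show i + (q - i + l) = q + l by omega]⟩
      · exact exists_ne_of_le hk h1
    · obtain ⟨x, rfl⟩ := Nat.exists_eq_add_of_le hi
      by_cases hd : 353 ∣ k
      · obtain ⟨m, rfl⟩ := hd
        -- `⌈x / 353⌉` indexes the first block start in the window, which contains `4 * m` of them.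
        obtain ⟨l, hl, h⟩ := ih m (by omega) ((x + 352) / 353) (by omega)
        refine ⟨353 * ((x + 352) / 353 + l) - x, by omega, ?_⟩
        rwa [show 75019 + x + (353 * ((x + 352) / 353 + l) - x) =
            75019 + 353 * ((x + 352) / 353 + l) by omega, leastWord_block,
          show 75019 + 353 * ((x + 352) / 353 + l) + 23 * (353 * m) =
            75019 + 353 * ((x + 352) / 353 + l + 23 * m) by omega, leastWord_block]
      · exact exists_ne_of_not_dvd hd

/-! ### Smaller letters are excluded -/

/-- The bound `27 * k ≤ p` makes the power start at position 1 or later, hence inside `w`. -/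
theorem exists_power_of_lt_aux {p c : ℕ} (hp : 1 ≤ p) (hp' : p < 75725) (hc : c < letter p) :
    ∃ k, 0 < k ∧ 27 * k ≤ p ∧ letter (p - 23 * k) = c ∧
      ∀ l < 4 * k - 1, letter (p + 1 - 27 * k + l) = letter (p + 1 - 27 * k + l + 23 * k) := by
  have hks : ∀ k ∈ parameters, 1 ≤ k ∧ 4 * k - 1 ≤ 2 ^ 14 := by decide
  have hS : ∀ M : ℕ, M.testBit p = true → ((M % 2 ^ 75725) >>> 1 <<< 1).testBit p = true := by
    intro M hM
    rw [Nat.testBit_shiftLeft, Nat.testBit_shiftRight, Nat.add_sub_cancel' hp,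
      testBit_mod_two_pow_of_lt _ hp', hM]
    simpa using hp
  obtain rfl | rfl : c = 0 ∨ c = 1 := by have := letter_le_two p; omega
  · have h1 : (ones ||| twos).testBit p = true := by
      rw [← Bool.not_eq_false, ← letter_eq_zero_iff]; omega
    obtain ⟨k, hk, h2, h3, h4⟩ := exists_of_uncovered hks (hS _ h1)
      (by rw [uncovered_zero, Nat.zero_testBit])
    exact ⟨k, (hks k hk).1, h2, letter_eq_zero_iff.2 h3, fun l hl => testBit_wordDiff.1 (h4 l hl)⟩
  · obtain ⟨k, hk, h2, h3, h4⟩ := exists_of_uncovered hks (hS _ (testBit_of_one_lt_letter hc))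
      (by rw [uncovered_one, Nat.zero_testBit])
    refine ⟨k, (hks k hk).1, h2, letter_eq_one ?_, fun l hl => testBit_wordDiff.1 (h4 l hl)⟩
    rw [Nat.testBit_xor, testBit_two_pow_sub_one_of_lt (by omega)] at h3
    simpa using h3

/-- Variable positions count as mismatches, so a clear bit certifies equality whatever letters the
blocks carry. The bounds are 4 and 32 blocks. -/
theorem of_testBit_blockDiff' {k x : ℕ} (hx : x < 1412) (hk : 23 * k + x < 11296)
    (h : (blockDiff' k).testBit x = false) :
    x % 353 ≠ 0 ∧ (x + 23 * k) % 353 ≠ 0 ∧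
      letter (75019 + x % 353) = letter (75019 + (x + 23 * k) % 353) := by
  have hb : x < 353 * 2 ^ 5 := by omega
  have hb' : 23 * k + x < 353 * 2 ^ 5 := by omega
  rw [blockDiff', Nat.testBit_or, Bool.or_eq_false_iff, testBit_diffMask, Nat.testBit_shiftRight,
    Nat.testBit_shiftRight, testBit_tile_ones hb, testBit_tile_twos hb, testBit_tile_ones hb',
    testBit_tile_twos hb', ← letter_eq_iff, Nat.testBit_xor, testBit_two_pow_sub_one_of_lt hx,
    Bool.true_xor, Bool.not_eq_false', Nat.testBit_and, Bool.and_eq_true,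
    Nat.testBit_shiftRight, testBit_tile_fixed hb, testBit_tile_fixed hb',
    Nat.add_comm (23 * k)] at h
  exact ⟨h.2.1, h.2.2, h.1⟩

theorem of_testBit_blockVar {x : ℕ} (hx : x < 1412) (h : blockVar.testBit x = false) :
    x % 353 ≠ 0 := by
  rwa [blockVar, Nat.testBit_xor, testBit_two_pow_sub_one_of_lt hx, Bool.true_xor,
    Bool.not_eq_false', testBit_tile_fixed (by omega)] at h

/-- Smaller letters at the fixed position `r` of a block are excluded by the fixed letters of this
and the preceding block. -/
theorem exists_power_block_aux {r c : ℕ} (h0 : r ≠ 0) (hr : r < 353) (hc : c < letter (75019 + r)) :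
    ∃ k, 0 < k ∧ k ≤ 10 ∧ (353 + r - 23 * k) % 353 ≠ 0 ∧
      letter (75019 + (353 + r - 23 * k) % 353) = c ∧
      ∀ l < 4 * k - 1, (blockDiff' k).testBit (353 + r + 1 - 27 * k + l) = false := by
  have hks : ∀ k ∈ parameters', 1 ≤ k ∧ 4 * k - 1 ≤ 2 ^ 14 := by decide
  have hks' : ∀ k ∈ parameters', k ≤ 10 := by decide
  have hS : ∀ M : ℕ, M.testBit r = true → ((M &&& blockFixed) <<< 353).testBit (353 + r) = true := by
    intro M hM
    rw [Nat.testBit_shiftLeft, Nat.add_sub_cancel_left, Nat.testBit_and, hM,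
      (testBit_blockFixed r).2 ⟨h0, hr⟩]
    simp
  obtain rfl | rfl : c = 0 ∨ c = 1 := by have := letter_le_two (75019 + r); omega
  · have h1 : (blockOnes ||| blockTwos).testBit r = true := by
      rw [Nat.testBit_or, testBit_blockOnes hr, testBit_blockTwos hr, ← Nat.testBit_or,
        ← Bool.not_eq_false, ← letter_eq_zero_iff]
      omega
    obtain ⟨k, hk, h2, h3, h4⟩ := exists_of_uncovered hks (hS _ h1)
      (by rw [uncovered_block_zero, Nat.zero_testBit])
    have hb : 353 + r - 23 * k < 353 * 2 ^ 5 := by omega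
    rw [Nat.testBit_or, Bool.or_eq_false_iff, Nat.testBit_or, testBit_tile_ones hb,
      testBit_tile_twos hb, ← Nat.testBit_or, ← letter_eq_zero_iff] at h3
    exact ⟨k, (hks k hk).1, hks' k hk, of_testBit_blockVar (by omega) h3.1, h3.2, h4⟩
  · have h1 : blockTwos.testBit r = true := by
      rw [testBit_blockTwos hr, testBit_of_one_lt_letter hc]
    obtain ⟨k, hk, h2, h3, h4⟩ := exists_of_uncovered hks (hS _ h1)
      (by rw [uncovered_block_one, Nat.zero_testBit])
    have hb : 353 + r - 23 * k < 353 * 2 ^ 5 := by omega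
    rw [Nat.testBit_or, Bool.or_eq_false_iff, Nat.testBit_xor, testBit_two_pow_sub_one_of_lt (by omega), Bool.true_xor, Bool.not_eq_false', testBit_tile_ones hb] at h3
    exact ⟨k, (hks k hk).1, hks' k hk, of_testBit_blockVar (by omega) h3.1, letter_eq_one h3.2, h4⟩

theorem exists_power_of_lt {p c : ℕ} (hp : 1 ≤ p) (hc : c < leastWord p) :
    ∃ k, 0 < k ∧ 27 * k ≤ p ∧ leastWord (p - 23 * k) = c ∧
      ∀ l < 4 * k - 1,
        leastWord (p + 1 - 27 * k + l) = leastWord (p + 1 - 27 * k + l + 23 * k) := by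
  induction p using Nat.strong_induction_on with
  | _ p ih =>
    rcases Nat.lt_or_ge p 75725 with h | h
    · rw [leastWord_eq_letter h] at hc
      obtain ⟨k, h1, h2, h3, h4⟩ := exists_power_of_lt_aux hp h hc
      refine ⟨k, h1, h2, by rwa [leastWord_eq_letter (by omega)], fun l hl => ?_⟩
      rw [leastWord_eq_letter (by omega), leastWord_eq_letter (by omega)]
      exact h4 l hl
    obtain ⟨x, rfl⟩ := Nat.exists_eq_add_of_le (show 75019 ≤ p by omega)
    by_cases hx : x % 353 = 0
    · obtain ⟨j, rfl⟩ := Nat.dvd_of_mod_eq_zero hx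
      rw [leastWord_block] at hc
      obtain ⟨k, h1, h2, h3, h4⟩ := ih j (by omega) (by omega) hc
      -- The enlarged window contains exactly `4 * k - 1` block starts, matched by the smaller
      -- power; all its other letters match because the period is a multiple of 353.
      refine ⟨353 * k, by omega, by omega, ?_, fun l hl => ?_⟩
      · rwa [show 75019 + 353 * j - 23 * (353 * k) = 75019 + 353 * (j - 23 * k) by omega,
          leastWord_block]
      · obtain ⟨y, hy⟩ : ∃ y, 75019 + 353 * j + 1 - 27 * (353 * k) + l = 75019 + y :=
          ⟨353 * j + 1 - 27 * (353 * k) + l, by omega⟩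
        rw [hy, Nat.add_assoc]
        by_cases hy0 : y % 353 = 0
        · obtain ⟨z, rfl⟩ := Nat.dvd_of_mod_eq_zero hy0
          obtain ⟨n, rfl⟩ := Nat.exists_eq_add_of_le (show j + 1 - 27 * k ≤ z by omega)
          rw [show 353 * (j + 1 - 27 * k + n) + 23 * (353 * k) =
            353 * (j + 1 - 27 * k + n + 23 * k) by ring, leastWord_block, leastWord_block]
          exact h4 n (by omega)
        · rw [leastWord_fixed hy0, leastWord_fixed (by omega)]
          congr 2
          omega
    · rw [leastWord_fixed hx] at hc
      obtain ⟨k, h1, h2, h3, h4, h5⟩ := exists_power_block_aux hx (by omega) hc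
      refine ⟨k, h1, by omega, ?_, fun l hl => ?_⟩
      · rw [show 75019 + x - 23 * k = 75019 + (x - 23 * k) by omega, leastWord_fixed (by omega),
          ← h4]
        congr 2
        omega
      · obtain ⟨h6, h7, h8⟩ := of_testBit_blockDiff' (by omega) (by omega) (h5 l hl)
        rw [show 75019 + x + 1 - 27 * k + l = 75019 + (x + 1 - 27 * k + l) by omega,
          Nat.add_assoc 75019, leastWord_fixed (by omega), leastWord_fixed (by omega)]
        convert h8 using 3 <;> omega

end LeastPowerFree

namespace Words

/-! ### Powers in factors -/

theorem length_factor {α : Type*} (w : ℕ → α) (i n : ℕ) : (factor w i n).length = n := by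
  simp [factor]

theorem factor_add {α : Type*} (w : ℕ → α) (i m n : ℕ) :
    factor w i (m + n) = factor w i m ++ factor w (i + m) n := by
  simp [factor, List.range_add, Nat.add_assoc]

theorem factor_eq_factor_iff {α : Type*} {w : ℕ → α} {i j n : ℕ} :
    factor w i n = factor w j n ↔ ∀ l < n, w (i + l) = w (j + l) := by
  simp [factor]

theorem isFracPower_factor_iff {α : Type*} {w : ℕ → α} {i n : ℕ} :
    IsFracPower 27 23 (factor w i n) ↔
      ∃ k, 0 < k ∧ n = 27 * k ∧ ∀ l < 4 * k, w (i + l) = w (i + l + 23 * k) := by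
  have hpow : ∀ (x : List α) (k : ℕ), x.length = 23 * k → fracPow 27 23 x = x ++ x.take (4 * k) := by
    intro x k hx
    simp only [fracPow, hx, Nat.reduceDiv, Nat.reduceMod, List.replicate_one, List.flatten_singleton]
    congr 2
    omega
  have htake : ∀ k, (factor w i (23 * k)).take (4 * k) = factor w i (4 * k) := by
    intro k
    rw [show 23 * k = 4 * k + 19 * k by omega, factor_add]
    exact List.take_left' (length_factor _ _ _)
  constructor
  · rintro ⟨x, hx0, ⟨k, hk⟩, hx⟩
    have hx' := List.length_pos_iff.2 hx0
    rw [hpow x k hk] at hx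
    have hn : n = 23 * k + 4 * k := by
      have := congrArg List.length hx
      simp only [length_factor, List.length_append, List.length_take, hk] at this
      omega
    rw [hn, factor_add] at hx
    obtain ⟨h1, h2⟩ := List.append_inj hx (by rw [length_factor, hk])
    rw [← h1, htake, factor_eq_factor_iff] at h2
    exact ⟨k, by omega, by omega, fun l hl => by rw [← h2 l hl, Nat.add_right_comm]⟩
  · rintro ⟨k, hk, rfl, h⟩
    have hl := length_factor w i (23 * k)
    refine ⟨factor w i (23 * k), List.length_pos_iff.1 (by omega), ⟨k, hl⟩, ?_⟩
    rw [hpow _ k hl, htake, show 27 * k = 23 * k + 4 * k by omega, factor_add]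
    congr 1
    exact factor_eq_factor_iff.2 fun l hl => by rw [h l hl, Nat.add_right_comm]

theorem powerFree_iff {α : Type*} {w : ℕ → α} :
    PowerFree 27 23 w ↔ ∀ i k, 0 < k → ∃ l < 4 * k, w (i + l) ≠ w (i + l + 23 * k) := by
  simp only [PowerFree, isFracPower_factor_iff]
  constructor
  · intro h i k hk
    by_contra! hc
    exact h i _ ⟨k, hk, rfl, hc⟩
  · rintro h i n ⟨k, hk, -, hc⟩
    obtain ⟨l, hl, hne⟩ := h i k hk
    exact hne (hc l hl)

/-- A power-free word is the lexicographically least one if replacing any of its letters by a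
smaller one produces a power that ends with this letter. -/
theorem isLexLeastPowerFree_of_forall_lt {w : ℕ → ℕ} (hw : PowerFree 27 23 w)
    (h : ∀ p, ∀ c < w p, ∃ k, 0 < k ∧ 27 * k ≤ p + 1 ∧ w (p - 23 * k) = c ∧
      ∀ l < 4 * k - 1, w (p + 1 - 27 * k + l) = w (p + 1 - 27 * k + l + 23 * k)) :
    IsLexLeastPowerFree 27 23 w := by
  refine ⟨hw, fun x hx => ?_⟩
  rw [← not_lt]
  -- At the first difference `p`, the smaller word has the prefix of `w` before `p`, so it contains
  -- the power ending at `p`.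
  rintro ⟨p, hlt, hp⟩
  obtain ⟨k, hk, hkp, hc, hl⟩ := h p _ hp
  have hx' : ∀ q < p, ofLex x q = w q := hlt
  obtain ⟨l, hl4, hne⟩ := powerFree_iff.1 hx (p + 1 - 27 * k) k hk
  apply hne
  rcases Nat.lt_or_ge l (4 * k - 1) with h1 | h1
  · rw [hx' _ (by omega), hx' _ (by omega), hl l h1]
  · rw [show p + 1 - 27 * k + l = p - 23 * k by omega, show p - 23 * k + 23 * k = p by omega,
      hx' _ (by omega), hc]
    rfl

/-! ### Automatic sequences -/

theorem baseValue_append {k : ℕ} (x : List (Fin k)) (d : Fin k) :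
    baseValue (x ++ [d]) = k * baseValue x + d := by
  simp [baseValue]

/-- A sequence is automatic if it factors through a map to a finite set for which the image of
`k * n + d` depends only on the image of `n` and the digit `d`. -/
theorem isAutomatic_of_forall_eq {Δ Q : Type} [Finite Q] {k : ℕ} {s : ℕ → Δ} (F : ℕ → Q)
    (out : Q → Δ) (hs : ∀ n, s n = out (F n))
    (hF : ∀ m n, F m = F n → ∀ d : Fin k, F (k * m + d) = F (k * n + d)) : IsAutomatic k s := by
  classical
  -- The transition picks any preimage of the state; `hF` makes the choice irrelevant.
  refine ⟨Q, inferInstance, F 0, fun q d => F (k * Function.invFun F q + d), out, fun x => ?_⟩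
  rw [hs]
  congr 1
  induction x using List.reverseRecOn with
  | nil => rfl
  | append_singleton x d ih =>
    rw [baseValue_append, List.foldl_append, ← ih, List.foldl_cons, List.foldl_nil]
    exact hF _ _ (Function.invFun_eq ⟨_, rfl⟩).symm d

end Words

namespace LeastPowerFree

open Words

/-! ### Minimality and automaticity of the word -/

theorem isLexLeastPowerFree_leastWord :
    IsLexLeastPowerFree 27 23 fun p => leastWord (p + 1) := by
  refine isLexLeastPowerFree_of_forall_lt (powerFree_iff.2 fun i k hk => ?_) fun p c hc => ?_
  · obtain ⟨l, hl, h⟩ := leastWord_exists_ne (i + 1) hk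
    refine ⟨l, hl, ?_⟩
    convert h using 2 <;> ring_nf
  · obtain ⟨k, h1, h2, h3, h4⟩ := exists_power_of_lt (Nat.le_add_left 1 p) hc
    refine ⟨k, h1, h2, ?_, fun l hl => ?_⟩
    · rw [← h3]
      congr 1
      omega
    · convert h4 l hl using 2 <;> omega

/-- The blocks begin about `213 * 353` letters in, so for large `n` the letters at `353 * n + d` and
at the offsets 213 and 214 before it depend on `d` and the letters 213 and 214 before `n`. Capping
at 1000 records small `n` exactly. -/
theorem isAutomatic_leastWord : IsAutomatic 353 fun p => leastWord (p + 1) := by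
  let val : ℕ → Fin 3 := fun p => ⟨leastWord p, by have := leastWord_le_two p; omega⟩
  have hval : ∀ {m n}, val m = val n ↔ leastWord m = leastWord n := Fin.mk_eq_mk
  let F : ℕ → Fin 1001 × Fin 3 × Fin 3 × Fin 3 := fun a =>
    (⟨min a 1000, by omega⟩, val (a + 1), val (a + 1 - 213), val (a + 1 - 214))
  refine isAutomatic_of_forall_eq F (fun q => q.2.1) (fun _ => rfl) fun m n hmn d => ?_
  obtain ⟨h1, -, h3, h4⟩ : min m 1000 = min n 1000 ∧ leastWord (m + 1) = leastWord (n + 1) ∧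
      leastWord (m + 1 - 213) = leastWord (n + 1 - 213) ∧
      leastWord (m + 1 - 214) = leastWord (n + 1 - 214) := by
    simpa only [F, Prod.mk.injEq, Fin.mk.injEq, hval] using hmn
  rcases Nat.lt_or_ge m 1000 with hm | hm
  · rw [show m = n by omega]
  have hn : 1000 ≤ n := by omega
  have key : ∀ e ≤ 214,
      leastWord (353 * m + d + 1 - e) = leastWord (353 * n + d + 1 - e) := by
    intro e he
    have hd := d.isLt
    -- Here `524 = 214 * 353 - 75019 + 1`.
    rw [show 353 * m + d + 1 - e = 75019 + (353 * (m - 214) + (d + 524 - e)) by omega,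
      show 353 * n + d + 1 - e = 75019 + (353 * (n - 214) + (d + 524 - e)) by omega]
    by_cases h0 : (d + 524 - e) % 353 = 0
    · obtain h5 | h5 : d + 524 - e = 353 ∨ d + 524 - e = 353 * 2 := by omega
      · rw [h5, ← Nat.mul_succ, ← Nat.mul_succ, leastWord_block, leastWord_block]
        convert h4 using 2 <;> omega
      · rw [h5, ← Nat.mul_add, ← Nat.mul_add, leastWord_block, leastWord_block]
        convert h3 using 2 <;> omega
    · rw [leastWord_fixed (by omega), leastWord_fixed (by omega), Nat.mul_add_mod, Nat.mul_add_mod]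
  simp only [F, Prod.mk.injEq, Fin.mk.injEq, hval]
  exact ⟨by omega, key 0 (by omega), key 213 (by omega), key 214 (by omega)⟩

/-! ### The morphism -/

/-- The fixed letters of the blocks. -/
def blockWord : List ℕ := factor leastWord 75020 352

/-- The letters before the first block, without the initial `0'`. -/
def initialWord : List ℕ := factor leastWord 2 75018

/-- The fixed point of the morphism. -/
def fixedPoint : ℕ → Letter
  | 0 => .zeroPrime
  | p + 1 => .int (leastWord (p + 2))

theorem tau_fixedPoint (p : ℕ) : tau (fixedPoint p) = leastWord (p + 1) := by
  cases p with
  | zero => exact leastWord_one.symm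
  | succ p => rfl

theorem factor_fixedPoint {i : ℕ} (hi : 0 < i) (n : ℕ) :
    factor fixedPoint i n = (factor leastWord (i + 1) n).map Letter.int := by
  obtain ⟨i, rfl⟩ := Nat.exists_eq_succ_of_ne_zero hi.ne'
  simp only [factor, List.map_map]
  refine List.map_congr_left fun j _ => ?_
  rw [Nat.succ_add, fixedPoint, Function.comp_apply]
  congr 2
  omega

/-- The morphism of which the word is the fixed point. -/
abbrev morphism : Letter → List Letter :=
  phi blockWord (Letter.zeroPrime :: initialWord.map Letter.int)

/-- Removing the front letter shifts the blocks by one, so the variable letter moves from the start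
of a block to its end, as in `φ(n) = u n`. -/
theorem factor_block (j : ℕ) :
    factor fixedPoint (75019 + 353 * j) 353 =
      blockWord.map Letter.int ++ [Letter.int (leastWord (j + 1))] := by
  rw [factor_fixedPoint (by omega), factor_add _ _ 352 1, List.map_append, blockWord]
  congr 2
  · simp only [factor]
    refine List.map_congr_left fun l hl => ?_
    rw [List.mem_range] at hl
    rw [show 75019 + 353 * j + 1 + l = 75019 + (353 * j + (1 + l)) by omega,
      show 75020 + l = 75019 + (1 + l) by omega, leastWord_fixed (by omega),
      leastWord_fixed (by omega), Nat.mul_add_mod]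
  · simp only [factor, List.range_one, List.map_cons, List.map_nil]
    rw [← leastWord_block (j + 1),
      show 75019 + 353 * j + 1 + 352 + 0 = 75019 + 353 * (j + 1) by omega]

/-- The morphism sends prefixes of the candidate to prefixes, so all iterates on `0'` are prefixes
of it. -/
theorem extend_factor (n : ℕ) :
    extend morphism (factor fixedPoint 0 (n + 1)) =
      factor fixedPoint 0 (75019 + 353 * (n + 1)) := by
  induction n with
  | zero =>
    have h : factor fixedPoint 0 (1 + 75018) =
        Letter.zeroPrime :: initialWord.map Letter.int := by
      rw [factor_add fixedPoint 0 1 75018, factor_fixedPoint (i := 0 + 1) (by omega)]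
      rfl
    rw [factor_add fixedPoint 0 75019 (353 * (0 + 1)), h, Nat.zero_add 75019]
    have h1 := factor_block 0
    rw [Nat.zero_add, leastWord_one] at h1
    rw [show 353 * (0 + 1) = 353 from rfl]
    refine Eq.trans ?_ (congrArg _ h1.symm)
    simp [factor, extend, phi, fixedPoint]
  | succ n ih =>
    rw [factor_add fixedPoint 0 (n + 1) 1,
      show 75019 + 353 * (n + 1 + 1) = 75019 + 353 * (n + 1) + 353 by ring,
      factor_add fixedPoint 0 (75019 + 353 * (n + 1)) 353, ← ih, Nat.zero_add, Nat.zero_add, factor_block]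
    simp [factor, extend, phi, fixedPoint]

theorem iterate_eq_factor (n : ℕ) :
    ∃ m, (extend morphism)^[n] [Letter.zeroPrime] = factor fixedPoint 0 (m + 1) := by
  induction n with
  | zero => exact ⟨0, rfl⟩
  | succ n ih =>
    obtain ⟨m, hm⟩ := ih
    exact ⟨75018 + 353 * (m + 1), by
      rw [Function.iterate_succ_apply', hm, extend_factor,
        show 75019 + 353 * (m + 1) = 75018 + 353 * (m + 1) + 1 by omega]⟩

theorem iterLimit_eq_fixedPoint (i : ℕ) :
    iterLimit morphism Letter.zeroPrime i = fixedPoint i := by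
  have hlt : i < ((extend morphism)^[i] [Letter.zeroPrime]).length := by
    refine lt_length_iterate (fun a => ?_) (c := Letter.zeroPrime) rfl (by simp) i
    cases a <;> simp [phi]
  obtain ⟨m, hm⟩ := iterate_eq_factor i
  rw [iterLimit]
  rw [hm, length_factor] at hlt
  simp [hm, factor, hlt]

theorem mem_of_mem_factor_leastWord {c i n : ℕ} (h : c ∈ factor leastWord i n) :
    c ∈ ({0, 1, 2} : Set ℕ) := by
  simp only [factor, List.mem_map] at h
  obtain ⟨j, -, rfl⟩ := h
  have := leastWord_le_two (i + j)
  simp only [Set.mem_insert_iff, Set.mem_singleton_iff]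
  omega

end LeastPowerFree

theorem mainTheorem5 :
    ∃ w : ℕ → ℕ, Words.IsLexLeastPowerFree 27 23 w ∧
      (∃ (u : List ℕ) (v : List Words.Letter) (t : List ℕ),
        (∀ c ∈ u, c ∈ ({0, 1, 2} : Set ℕ)) ∧ u.length = 352 ∧
        v = Words.Letter.zeroPrime :: t.map Words.Letter.int ∧
        (∀ c ∈ t, c ∈ ({0, 1, 2} : Set ℕ)) ∧ v.length = 75019 ∧
        ∀ i : ℕ, w i =
          Words.tau (Words.iterLimit (Words.phi u v) Words.Letter.zeroPrime i)) ∧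
      (∀ i : ℕ, w i ∈ ({0, 1, 2} : Set ℕ)) ∧
      Words.IsAutomatic 353 w := by
  refine ⟨fun p => LeastPowerFree.leastWord (p + 1), LeastPowerFree.isLexLeastPowerFree_leastWord,
    ⟨LeastPowerFree.blockWord, _, LeastPowerFree.initialWord,
      fun c => LeastPowerFree.mem_of_mem_factor_leastWord, Words.length_factor _ _ _, rfl,
      fun c => LeastPowerFree.mem_of_mem_factor_leastWord, ?_, fun i => ?_⟩,
    fun i => LeastPowerFree.mem_of_mem_factor_leastWord (i := i + 1) (n := 1) (by simp [Words.factor]),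
    LeastPowerFree.isAutomatic_leastWord⟩
  · rw [List.length_cons, List.length_map, LeastPowerFree.initialWord, Words.length_factor]
  · rw [LeastPowerFree.iterLimit_eq_fixedPoint, LeastPowerFree.tau_fixedPoint]
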